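/- **Syntax.** Fix a vocabulary of atomic concepts and atomic roles. $\mathcal{EL}_\bot$ concepts are given by $C,D ::= A\mid\top\mid\bot\mid C\sqcap D\mid\exists r.C$; $\mathcal{ALC}$ concepts additionally allow $\neg C$. A defeasible ontology is a pair $\mathcal K=\langle\mathcal T,\mathcal D\rangle$ of a finite set $\mathcal T$ of inclusions $C\sqsubseteq D$ and a finite set $\mathcal D$ of defeasible inclusions $C\mathrel{\sqsubset\!\!\!\!\sim}D$; it is an $\mathcal{EL}_\bot$ ontology if all its concepts are $\mathcal{EL}_\bot$ concepts. $\mathcal T\models C\sqsubseteq D$ is classical entailment: $C^I\subseteq D^I$ in every interpretation $I$ (with non-empty domain) that satisfies $\mathcal T$. **Rational Closure.** A ranked interpretation is an interpretation $R$ with a relation $\prec$ on its domain such that, for some $\mathrm{rk}:\Delta^R\to\mathbb N$, $o\prec p$ iff $\mathrm{rk}(o)<\mathrm{rk}(p)$. It satisfies $C\sqsubseteq D$ iff $C^R\subseteq D^R$, and $C\mathrel{\sqsubset\!\!\!\!\sim}D$ iff $\min_\prec(C^R)\subseteq D^R$; it is a model of $\mathcal K$ if it satisfies all axioms of $\mathcal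 T$ and $\mathcal D$. A concept $C$ is exceptional w.r.t. $\mathcal K$ if every ranked model of $\mathcal K$ satisfies $\top\mathrel{\sqsubset\!\!\!\!\sim}\neg C$. Put $\mathcal K^0=\mathcal K$, and let $\mathcal K^{i+1}$ be obtained from $\mathcal K^i$ by deleting from its set of defeasible axioms those whose left-hand side is not exceptional w.r.t. $\mathcal K^i$. The rank $r_{\mathcal K}(C)\in\mathbb N\cup\{\infty\}$ is the least $i$ such that $C$ is not exceptional w.r.t. $\mathcal K^i$, and $\infty$ if there is none. $C\mathrel{\sqsubset\!\!\!\!\sim}D$ is in the Rational Closure of $\mathcal K$ iff $r_{\mathcal K}(C\sqcap D)<r_{\mathcal K}(C\sqcap\neg D)$ or $r_{\mathcal K}(C)=\infty$. **Procedure.** For a TBox $\mathcal T$ and a finite set $\mathcal E$ of defeasible inclusions let $\mathcal T_{\delta,\mathcal E}=\mathcal T\cup\{E\sqcap\delta\sqsubseteq F\mid E\mathrel{\sqsubset\!\!\!\!\sim}F\in\mathcal E\}$, where $\delta$ is a new atomic concept, and let $\mathtt{Exceptional}(\mathcal T,\mathcal E)$ be the set of all $E\mathrel{\sqsubset\!\!\!\!\sim}F\in\mathcal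 E$ with $\mathcal T_{\delta,\mathcal E}\models E\sqcap\delta\sqsubseteq\bot$. $\mathtt{ComputeRanking}(\mathcal K)$: start with $\mathcal T^*=\mathcal T$, $\mathcal D^*=\mathcal D$. Repeat: put $\mathcal E_0=\mathcal D^*$, $\mathcal E_{j+1}=\mathtt{Exceptional}(\mathcal T^*,\mathcal E_j)$ up to the first $i$ with $\mathcal E_{i+1}=\mathcal E_i$; put $\mathcal D_\infty=\mathcal E_i$, replace $\mathcal D^*$ by $\mathcal D^*\setminus\mathcal D_\infty$, and add $E\sqsubseteq\bot$ to $\mathcal T^*$ for every $E\mathrel{\sqsubset\!\!\!\!\sim}F\in\mathcal D_\infty$; stop when $\mathcal D_\infty=\emptyset$. Return $\mathcal T^*$, $\mathcal D^*$ and the sets $\mathcal D_{j}=\mathcal E_{j}\setminus\mathcal E_{j+1}$ ($0\le j<i$) of the last round. $\mathtt{RationalClosure}(\mathcal K,C\mathrel{\sqsubset\!\!\!\!\sim}D)$: if $\mathcal T\models C\sqsubseteq D$, return true. Run $\mathtt{ComputeRanking}(\mathcal K)$. If $\mathcal T^*\models C\sqsubseteq D$, return true. Put $i=0$, $\mathcal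 D_R=\mathcal D^*$; while $\mathcal T^*_{\delta,\mathcal D_R}\models C\sqcap\delta\sqsubseteq\bot$ and $\mathcal D_R\neq\emptyset$, replace $\mathcal D_R$ by $\mathcal D_R\setminus\mathcal D_i$ and $i$ by $i+1$. If then $\mathcal T^*_{\delta,\mathcal D_R}\not\models C\sqcap\delta\sqsubseteq\bot$, return the truth value of $\mathcal T^*_{\delta,\mathcal D_R}\models C\sqcap\delta\sqsubseteq D$; otherwise return false. The procedure accesses entailment only through classical $\mathcal{EL}_\bot$ subsumption tests, which may be carried out by any correct classical $\mathcal{EL}_\bot$ subsumption tester. **Proposition.** Let $\mathcal K=\langle\mathcal T,\mathcal D\rangle$ be a defeasible $\mathcal{EL}_\bot$ ontology and $C\mathrel{\sqsubset\!\!\!\!\sim}D$ a defeasible inclusion between $\mathcal{EL}_\bot$ concepts. Then $C\mathrel{\sqsubset\!\!\!\!\sim}D$ is in the Rational Closure of $\mathcal K$ if and only if $\mathtt{RationalClosure}(\mathcal K,C\mathrel{\sqsubset\!\!\!\!\sim}D)$ returns true. -/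

import Mathlib

universe w u v

namespace DefeasibleEL

/-! ## Concepts -/

/-- `EL⊥` concepts over the atomic concepts `NC` and the atomic roles `NR`. -/
inductive ELConcept (NC : Type u) (NR : Type v) : Type (max u v)
  | atom (A : NC)
  | top
  | bot
  | inf (C D : ELConcept NC NR)
  | ex (r : NR) (C : ELConcept NC NR)
  deriving DecidableEq

/-- `ALC` concepts: `EL⊥` extended with concept negation. -/
inductive ALCConcept (NC : Type u) (NR : Type v) : Type (max u v)
  | atom (A : NC)
  | top
  | bot
  | inf (C D : ALCConcept NC NR)
  | ex (r : NR) (C : ALCConcept NC NR)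
  | neg (C : ALCConcept NC NR)
  deriving DecidableEq

/-- `EL⊥` is a sublanguage of `ALC`. -/
def ELConcept.toALC {NC : Type u} {NR : Type v} : ELConcept NC NR → ALCConcept NC NR
  | .atom A => .atom A
  | .top => .top
  | .bot => .bot
  | .inf C D => .inf C.toALC D.toALC
  | .ex r C => .ex r C.toALC

/-! ## Axioms and ontologies -/

/-- A classical general concept inclusion `lhs ⊑ rhs`. -/
structure GCI (X : Type u) where
  lhs : X
  rhs : X
  deriving DecidableEq

/-- A defeasible general concept inclusion `lhs ⊏∼ rhs`. -/
structure DGCI (X : Type u) where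
  lhs : X
  rhs : X
  deriving DecidableEq

/-- A defeasible ontology `⟨T, D⟩`: a finite TBox and a finite DBox. -/
structure Ontology (X : Type u) where
  tbox : Finset (GCI X)
  dbox : Finset (DGCI X)

/-- An `EL⊥` ontology, seen as an `ALC` ontology. -/
def Ontology.toALC {NC : Type u} {NR : Type v} [DecidableEq NC] [DecidableEq NR]
    (K : Ontology (ELConcept NC NR)) : Ontology (ALCConcept NC NR) where
  tbox := K.tbox.image fun a => ⟨a.lhs.toALC, a.rhs.toALC⟩
  dbox := K.dbox.image fun a => ⟨a.lhs.toALC, a.rhs.toALC⟩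

/-! ## Classical semantics -/

/-- A (classical) interpretation, with a non-empty domain. -/
structure Interpretation (NC : Type u) (NR : Type v) : Type (max (w + 1) u v) where
  Dom : Type w
  nonempty : Nonempty Dom
  atom : NC → Set Dom
  role : NR → Set (Dom × Dom)

/-- The extension `C^I` of an `ALC` concept. -/
def ALCConcept.ext {NC : Type u} {NR : Type v} (I : Interpretation.{w} NC NR) :
    ALCConcept NC NR → Set I.Dom
  | .atom A => I.atom A
  | .top => Set.univ
  | .bot => ∅
  | .inf C D => C.ext I ∩ D.ext I
  | .ex r C => {o | ∃ o', (o, o') ∈ I.role r ∧ o' ∈ C.ext I}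
  | .neg C => (C.ext I)ᶜ

/-- The extension `C^I` of an `EL⊥` concept. -/
def ELConcept.ext {NC : Type u} {NR : Type v} (I : Interpretation.{w} NC NR) :
    ELConcept NC NR → Set I.Dom
  | .atom A => I.atom A
  | .top => Set.univ
  | .bot => ∅
  | .inf C D => C.ext I ∩ D.ext I
  | .ex r C => {o | ∃ o', (o, o') ∈ I.role r ∧ o' ∈ C.ext I}

/-- The two semantics agree on `EL⊥`. -/
theorem ELConcept.ext_toALC {NC : Type u} {NR : Type v} (I : Interpretation.{w} NC NR)
    (C : ELConcept NC NR) : C.toALC.ext I = C.ext I := by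
  induction C with
  | atom A => rfl
  | top => rfl
  | bot => rfl
  | inf C D hC hD => simp only [toALC, ALCConcept.ext, ext, hC, hD]
  | ex r C hC => simp only [toALC, ALCConcept.ext, ext, hC]

/-- Classical `EL⊥` entailment `T ⊨ C ⊑ D`: every model of `T` satisfies `C ⊑ D`. -/
def Entails.{w', u', v'} {NC : Type u'} {NR : Type v'} (T : Finset (GCI (ELConcept NC NR)))
    (C D : ELConcept NC NR) : Prop :=
  ∀ I : Interpretation.{w'} NC NR, (∀ a ∈ T, a.lhs.ext I ⊆ a.rhs.ext I) → C.ext I ⊆ D.ext I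

/-! ## Ranked interpretations and Rational Closure -/

/-- A ranked interpretation: an interpretation with a modular preference relation. (That `prec`
is a strict partial order follows from modularity.) -/
structure RankedInterpretation (NC : Type u) (NR : Type v) : Type (max (w + 1) u v)
    extends Interpretation.{w} NC NR where
  prec : Dom → Dom → Prop
  modular : ∃ rk : Dom → ℕ, ∀ o p, prec o p ↔ rk o < rk p

/-- The `≺`-minimal elements of a set of objects. -/
def RankedInterpretation.minimals {NC : Type u} {NR : Type v}
    (R : RankedInterpretation.{w} NC NR) (X : Set R.Dom) : Set R.Dom :=
  {x | x ∈ X ∧ ¬ ∃ y ∈ X, R.prec y x}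

/-- `R ⊩ C ⊑ D`. -/
def RankedInterpretation.SatGCI {NC : Type u} {NR : Type v}
    (R : RankedInterpretation.{w} NC NR) (a : GCI (ALCConcept NC NR)) : Prop :=
  a.lhs.ext R.toInterpretation ⊆ a.rhs.ext R.toInterpretation

/-- `R ⊩ C ⊏∼ D`: the most typical instances of `C` are instances of `D`. -/
def RankedInterpretation.SatDGCI {NC : Type u} {NR : Type v}
    (R : RankedInterpretation.{w} NC NR) (a : DGCI (ALCConcept NC NR)) : Prop :=
  R.minimals (a.lhs.ext R.toInterpretation) ⊆ a.rhs.ext R.toInterpretation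

/-- `R` is a ranked model of the ontology `K`. -/
def RankedInterpretation.IsModel {NC : Type u} {NR : Type v}
    (R : RankedInterpretation.{w} NC NR) (K : Ontology (ALCConcept NC NR)) : Prop :=
  (∀ a ∈ K.tbox, R.SatGCI a) ∧ ∀ a ∈ K.dbox, R.SatDGCI a

/-- Ranked entailment of a defeasible inclusion. -/
def RankedEntails.{w', u', v'} {NC : Type u'} {NR : Type v'} (K : Ontology (ALCConcept NC NR))
    (a : DGCI (ALCConcept NC NR)) : Prop :=
  ∀ R : RankedInterpretation.{w'} NC NR, R.IsModel K → R.SatDGCI a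

/-- `C` is exceptional w.r.t. `K` iff `K` rationally entails `⊤ ⊏∼ ¬C`. -/
def IsExceptional.{w', u', v'} {NC : Type u'} {NR : Type v'} (K : Ontology (ALCConcept NC NR))
    (C : ALCConcept NC NR) : Prop :=
  RankedEntails.{w'} K ⟨.top, .neg C⟩

open scoped Classical in
/-- The ontologies `K^i` of the semantic ranking: `K^0 = K`, and `K^(i+1)` is obtained from `K^i`
by removing from the DBox the axioms of rank `i`, i.e. those whose antecedent is not exceptional
w.r.t. `K^i`. -/
noncomputable def level.{w', u', v'} {NC : Type u'} {NR : Type v'}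
    (K : Ontology (ALCConcept NC NR)) : ℕ → Ontology (ALCConcept NC NR)
  | 0 => K
  | i + 1 =>
    { tbox := K.tbox
      dbox := (level K i).dbox.filter fun a => IsExceptional.{w'} (level K i) a.lhs }

/-- The semantic rank of a concept: the least `i` such that `C` is not exceptional w.r.t. `K^i`,
and `∞` if there is no such `i`. -/
noncomputable def conceptRank.{w', u', v'} {NC : Type u'} {NR : Type v'}
    (K : Ontology (ALCConcept NC NR)) (C : ALCConcept NC NR) : ℕ∞ :=
  sInf {n : ℕ∞ | ∃ i : ℕ, n = i ∧ ¬ IsExceptional.{w'} (level.{w'} K i) C}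

/-- `C ⊏∼ D` is in the Rational Closure of `K`. -/
def InRationalClosure.{w', u', v'} {NC : Type u'} {NR : Type v'}
    (K : Ontology (ALCConcept NC NR)) (C D : ALCConcept NC NR) : Prop :=
  conceptRank.{w'} K (.inf C D) < conceptRank.{w'} K (.inf C (.neg D)) ∨
    conceptRank.{w'} K C = ⊤

/-! ## The decision procedure

The procedures below access entailment only through a classical `EL⊥` subsumption tester. -/

/-- A classical `EL⊥` subsumption tester: given a set of atomic concepts `N`, a TBox `T` and
concepts `C`, `D` over `N`, it answers whether `T ⊨ C ⊑ D`. -/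
def SubsumptionTest (NR : Type v) : Type (max (u + 1) v) :=
  (N : Type u) → Finset (GCI (ELConcept N NR)) → ELConcept N NR → ELConcept N NR → Bool

/-- The tester always gives the right answer. -/
def SubsumptionTest.Correct.{w', u', v'} {NR : Type v'} (test : SubsumptionTest.{u'} NR) : Prop :=
  ∀ (N : Type u') (T : Finset (GCI (ELConcept N NR))) (C D : ELConcept N NR),
    test N T C D = true ↔ Entails.{w'} T C D

/-- A concept over `NC`, read over the vocabulary `Option NC`, which has exactly one new atomic
concept, `none`. -/
def ELConcept.lift {NC : Type u} {NR : Type v} : ELConcept NC NR → ELConcept (Option NC) NR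
  | .atom A => .atom (some A)
  | .top => .top
  | .bot => .bot
  | .inf C D => .inf C.lift D.lift
  | .ex r C => .ex r C.lift

/-- The concept `C ⊓ δ`, where `δ` is the new atomic concept. -/
def ELConcept.withDelta {NC : Type u} {NR : Type v} (C : ELConcept NC NR) :
    ELConcept (Option NC) NR :=
  .inf C.lift (.atom none)

variable {NC : Type u} {NR : Type v} [DecidableEq NC] [DecidableEq NR]

/-- `T_δ = T ∪ {E ⊓ δ ⊑ F | E ⊏∼ F ∈ 𝓔}`. -/
def deltaTBox (T : Finset (GCI (ELConcept NC NR))) (E : Finset (DGCI (ELConcept NC NR))) :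
    Finset (GCI (ELConcept (Option NC) NR)) :=
  T.image (fun a => ⟨a.lhs.lift, a.rhs.lift⟩) ∪
    E.image (fun a => ⟨a.lhs.withDelta, a.rhs.lift⟩)

/-- Procedure `Exceptional(T, 𝓔)`. -/
def exceptional (test : SubsumptionTest.{u} NR) (T : Finset (GCI (ELConcept NC NR)))
    (E : Finset (DGCI (ELConcept NC NR))) : Finset (DGCI (ELConcept NC NR)) :=
  E.filter fun a => test (Option NC) (deltaTBox T E) a.lhs.withDelta .bot = true

/-- The inner `while` loop of `ComputeRanking`, started with `𝓔₀ = E`: with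
`𝓔_{j+1} = Exceptional(T, 𝓔_j)` and `i` the first index such that `𝓔_{i+1} = 𝓔_i`, it returns the
list `[𝓔₀, …, 𝓔_{i-1}]` together with `𝓔_i`. -/
def exceptionalChain (test : SubsumptionTest.{u} NR) (T : Finset (GCI (ELConcept NC NR)))
    (E : Finset (DGCI (ELConcept NC NR))) :
    List (Finset (DGCI (ELConcept NC NR))) × Finset (DGCI (ELConcept NC NR)) :=
  if exceptional test T E = E then ([], E)
  else
    let s := exceptionalChain test T (exceptional test T E)
    (E :: s.1, s.2)
  termination_by E.card
  decreasing_by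
    exact Finset.card_lt_card
      (Finset.ssubset_iff_subset_ne.2 ⟨Finset.filter_subset _ _, by assumption⟩)

theorem exceptionalChain_snd_subset (test : SubsumptionTest.{u} NR)
    (T : Finset (GCI (ELConcept NC NR))) (E : Finset (DGCI (ELConcept NC NR))) :
    (exceptionalChain test T E).2 ⊆ E := by
  induction E using exceptionalChain.induct test T with
  | case1 E h => rw [exceptionalChain, if_pos h]
  | case2 E h ih =>
    rw [exceptionalChain, if_neg h]
    exact ih.trans (Finset.filter_subset _ _)

/-- Procedure `ComputeRanking(⟨T, D⟩)`. It returns `⟨⟨T*, D*⟩, [D₀, …, D_n]⟩`, where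
`D_{j-1} = 𝓔_{j-1} \ 𝓔_j` for the sequence `𝓔₀, …, 𝓔_i` of the last round. -/
def computeRanking (test : SubsumptionTest.{u} NR) (T : Finset (GCI (ELConcept NC NR)))
    (D : Finset (DGCI (ELConcept NC NR))) :
    Ontology (ELConcept NC NR) × List (Finset (DGCI (ELConcept NC NR))) :=
  let chain := exceptionalChain test T D
  let Dinf := chain.2
  let D' := D \ Dinf
  let T' := T ∪ Dinf.image fun a => ⟨a.lhs, .bot⟩
  if Dinf = ∅ then
    (⟨T', D'⟩, List.zipWith (fun X Y => X \ Y) chain.1 (chain.1.tail ++ [Dinf]))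
  else computeRanking test T' D'
  termination_by D.card
  decreasing_by
    rename_i h
    obtain ⟨x, hx⟩ := Finset.nonempty_iff_ne_empty.2 h
    refine Finset.card_lt_card (Finset.ssubset_iff_subset_ne.2 ⟨Finset.sdiff_subset, fun he => ?_⟩)
    have hxD : x ∈ D := exceptionalChain_snd_subset test T D hx
    rw [← he] at hxD
    exact (Finset.mem_sdiff.1 hxD).2 hx

/-- The `while` loop of `RationalClosure`: given the current DBox `D_R` and the remaining layers
`[D_i, D_{i+1}, …]`, the layers are removed one after the other as long as
`T_δ ⊨ C ⊓ δ ⊑ ⊥` and `D_R ≠ ∅`; the final `D_R` is returned. -/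
def searchRank (test : SubsumptionTest.{u} NR) (T : Finset (GCI (ELConcept NC NR)))
    (C : ELConcept NC NR) :
    Finset (DGCI (ELConcept NC NR)) → List (Finset (DGCI (ELConcept NC NR))) →
      Finset (DGCI (ELConcept NC NR))
  | DR, [] => DR
  | DR, Di :: L =>
    if test (Option NC) (deltaTBox T DR) C.withDelta .bot = true ∧ DR ≠ ∅ then
      searchRank test T C (DR \ Di) L
    else DR

/-- Procedure `RationalClosure(K, C ⊏∼ D)`. -/
def rationalClosure (test : SubsumptionTest.{u} NR) (K : Ontology (ELConcept NC NR))
    (C D : ELConcept NC NR) : Bool :=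
  if test NC K.tbox C D = true then true
  else
    let ranking := computeRanking test K.tbox K.dbox
    let T := ranking.1.tbox
    let CL := test NC T C D
    if CL = true then CL
    else
      let DR := searchRank test T C ranking.1.dbox ranking.2
      if test (Option NC) (deltaTBox T DR) C.withDelta .bot = false then
        test (Option NC) (deltaTBox T DR) C.withDelta D.lift
      else CL

end DefeasibleEL

/-! Interpreting δ by a singleton turns each test on `deltaTBox T E` into a statement about single
objects of models of `T` that satisfy the material implications of `E` (`entails_withDelta_iff`).
The heart is `isExceptional_toALC_iff`: if iterating `exceptional` empties `E`, this material test
decides ranked exceptionality. A counterexample to the test becomes a ranked model by adding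
disjointly, for each axiom, a witness that it leaves the sequence, and ranking every object by the
first stage whose implications it satisfies.

A nonempty fixed point of `exceptional` blocks this, but its left-hand sides are empty in every
ranked model, so moving them to the TBox as `E ⊑ ⊥` preserves ranked models (`isModel_union_iff`).
Hence the semantic levels are the syntactic stages plus axioms with unsatisfiable left-hand sides
(`level_toALC_eq`).

The search then finds the first level `j` where `C` is not exceptional. There, `C ⊏∼ D` is in the
closure exactly when `C ⊓ ¬D` is exceptional at `j`, which is the final test. -/

namespace DefeasibleEL

/-! ### Material satisfaction, δ-expansions and disjoint unions. -/

section Interpretations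

variable {NC : Type u} {NR : Type v}

/-- `I` satisfies all inclusions of the TBox `T`. -/
def Interpretation.SatTBox (I : Interpretation.{w} NC NR) (T : Finset (GCI (ELConcept NC NR))) :
    Prop :=
  ∀ a ∈ T, a.lhs.ext I ⊆ a.rhs.ext I

/-- The object `x` satisfies the material counterparts of all defeasible inclusions in `E`. -/
def Interpretation.Typical (I : Interpretation.{w} NC NR) (E : Finset (DGCI (ELConcept NC NR)))
    (x : I.Dom) : Prop :=
  ∀ a ∈ E, x ∈ a.lhs.ext I → x ∈ a.rhs.ext I

theorem Interpretation.typical_empty (I : Interpretation.{w} NC NR) (x : I.Dom) :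
    I.Typical ∅ x :=
  fun _ ha => absurd ha (Finset.notMem_empty _)

/-- The restriction to the original vocabulary of an interpretation that interprets `δ`. -/
def Interpretation.reduct (I : Interpretation.{w} (Option NC) NR) : Interpretation.{w} NC NR where
  Dom := I.Dom
  nonempty := I.nonempty
  atom A := I.atom (some A)
  role := I.role

/-- The expansion of an interpretation in which `δ` is interpreted by `S`. -/
def Interpretation.expand (I : Interpretation.{w} NC NR) (S : Set I.Dom) :
    Interpretation.{w} (Option NC) NR where
  Dom := I.Dom
  nonempty := I.nonempty
  atom A := A.elim S I.atom
  role := I.role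

theorem ELConcept.ext_lift (I : Interpretation.{w} (Option NC) NR) (C : ELConcept NC NR) :
    C.lift.ext I = C.ext I.reduct := by
  induction C with
  | atom A => rfl
  | top => rfl
  | bot => rfl
  | inf C D hC hD => simp only [lift, ext, hC, hD]; rfl
  | ex r C hC => simp only [lift, ext, hC]; rfl

theorem ELConcept.ext_withDelta (I : Interpretation.{w} (Option NC) NR) (C : ELConcept NC NR) :
    C.withDelta.ext I = (C.ext I.reduct ∩ I.atom none : Set I.Dom) := by
  simp only [withDelta, ext, ext_lift]

/-- The disjoint union of a family of interpretations. -/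
def Interpretation.sigma {ι : Type} [hι : Nonempty ι] (I : ι → Interpretation.{w} NC NR) :
    Interpretation.{w} NC NR where
  Dom := Σ i, (I i).Dom
  nonempty := hι.elim fun i => (I i).nonempty.elim fun x => ⟨⟨i, x⟩⟩
  atom A := {x | x.2 ∈ (I x.1).atom A}
  role r := {p | ∃ (i : ι) (x y : (I i).Dom), p = (⟨i, x⟩, ⟨i, y⟩) ∧ (x, y) ∈ (I i).role r}

/-- Roles never cross components, so evaluation is local to each of them, even under negation. -/
theorem ALCConcept.mem_ext_sigma {ι : Type} [Nonempty ι] (I : ι → Interpretation.{w} NC NR)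
    (C : ALCConcept NC NR) (i : ι) (x : (I i).Dom) :
    (⟨i, x⟩ : Σ i, (I i).Dom) ∈ C.ext (Interpretation.sigma I) ↔ x ∈ C.ext (I i) := by
  induction C generalizing i x with
  | atom A => exact Iff.rfl
  | top => exact Iff.rfl
  | bot => exact Iff.rfl
  | inf C D hC hD => exact and_congr (hC i x) (hD i x)
  | neg C hC => exact not_congr (hC i x)
  | ex r C hC =>
    constructor
    · rintro ⟨_, ⟨j, y, z, hp, hr⟩, hz⟩
      obtain ⟨h1, rfl⟩ := Prod.mk.inj hp
      cases h1
      exact ⟨z, hr, (hC _ _).1 hz⟩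
    · rintro ⟨y, hr, hy⟩
      exact ⟨⟨i, y⟩, ⟨i, x, y, rfl, hr⟩, (hC _ _).2 hy⟩

theorem ELConcept.mem_ext_sigma {ι : Type} [Nonempty ι] (I : ι → Interpretation.{w} NC NR)
    (C : ELConcept NC NR) (i : ι) (x : (I i).Dom) :
    (⟨i, x⟩ : Σ i, (I i).Dom) ∈ C.ext (Interpretation.sigma I) ↔ x ∈ C.ext (I i) := by
  rw [← ELConcept.ext_toALC, ← ELConcept.ext_toALC, ALCConcept.mem_ext_sigma]

theorem Interpretation.typical_sigma {ι : Type} [Nonempty ι] (I : ι → Interpretation.{w} NC NR)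
    (E : Finset (DGCI (ELConcept NC NR))) (i : ι) (x : (I i).Dom) :
    (Interpretation.sigma I).Typical E (⟨i, x⟩ : Σ i, (I i).Dom) ↔ (I i).Typical E x :=
  forall₂_congr fun _ _ => imp_congr (ELConcept.mem_ext_sigma I _ i x)
    (ELConcept.mem_ext_sigma I _ i x)

theorem Interpretation.satTBox_sigma {ι : Type} [Nonempty ι] {I : ι → Interpretation.{w} NC NR}
    {T : Finset (GCI (ELConcept NC NR))} (h : ∀ i, (I i).SatTBox T) :
    (Interpretation.sigma I).SatTBox T := by
  rintro a ha ⟨i, x⟩ hx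
  exact (ELConcept.mem_ext_sigma I _ i x).2 (h i a ha ((ELConcept.mem_ext_sigma I _ i x).1 hx))

/-- The preference relation of a ranked interpretation induced by a rank function. -/
def Interpretation.ranked (I : Interpretation.{w} NC NR) (rk : I.Dom → ℕ) :
    RankedInterpretation.{w} NC NR where
  toInterpretation := I
  prec o p := rk o < rk p
  modular := ⟨rk, fun _ _ => Iff.rfl⟩

end Interpretations

/-! ### Exceptionality and concept rank. -/

section ConceptRank

variable {NC : Type u} {NR : Type v} {K : Ontology (ALCConcept NC NR)} {X : ALCConcept NC NR}

theorem isExceptional_iff :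
    IsExceptional.{w} K X ↔ ∀ R : RankedInterpretation.{w} NC NR, R.IsModel K →
      ∀ x, (∀ y, ¬ R.prec y x) → x ∉ X.ext R.toInterpretation := by
  refine forall₂_congr fun R _ => ⟨fun h x hx => h ⟨trivial, ?_⟩, fun h x hx => h x ?_⟩
  · rintro ⟨y, -, hy⟩
    exact hx y hy
  · exact fun y hy => hx.2 ⟨y, trivial, hy⟩

theorem conceptRank_le {i : ℕ} (h : ¬ IsExceptional.{w} (level.{w} K i) X) :
    conceptRank.{w} K X ≤ i :=
  sInf_le ⟨i, rfl, h⟩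

theorem conceptRank_eq_top_iff :
    conceptRank.{w} K X = ⊤ ↔ ∀ i, IsExceptional.{w} (level.{w} K i) X := by
  rw [conceptRank, sInf_eq_top]
  constructor
  · intro h i
    by_contra hi
    exact ENat.natCast_ne_top i (h i ⟨i, rfl, hi⟩)
  · rintro h _ ⟨i, rfl, hi⟩
    exact absurd (h i) hi

theorem isExceptional_of_lt_conceptRank {i : ℕ} (h : (i : ℕ∞) < conceptRank.{w} K X) :
    IsExceptional.{w} (level.{w} K i) X := by
  by_contra hi
  exact absurd h (not_lt.2 (conceptRank_le hi))

/-- An infimum of a nonempty subset of `ℕ∞` is attained. -/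
theorem exists_conceptRank_eq (h : conceptRank.{w} K X ≠ ⊤) :
    ∃ i : ℕ, conceptRank.{w} K X = i ∧ ¬ IsExceptional.{w} (level.{w} K i) X := by
  have hne : {n : ℕ∞ | ∃ i : ℕ, n = i ∧ ¬ IsExceptional.{w} (level.{w} K i) X}.Nonempty := by
    rw [Set.nonempty_iff_ne_empty]
    intro he
    rw [conceptRank, he, sInf_empty] at h
    exact h rfl
  exact csInf_mem hne

theorem lt_conceptRank {j : ℕ} (h : ∀ i ≤ j, IsExceptional.{w} (level.{w} K i) X) :
    (j : ℕ∞) < conceptRank.{w} K X := by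
  by_contra hlt
  obtain ⟨i, hi, hX⟩ := exists_conceptRank_eq
    (ne_top_of_le_ne_top (ENat.natCast_ne_top j) (not_lt.1 hlt))
  rw [hi, not_lt] at hlt
  exact hX (h i (Nat.cast_le.1 hlt))

end ConceptRank

/-! ### The δ-encoding and the materialisation test. -/

section Procedure

variable {NC : Type u} {NR : Type v} [DecidableEq NC] [DecidableEq NR]

theorem satTBox_deltaTBox (T : Finset (GCI (ELConcept NC NR)))
    (E : Finset (DGCI (ELConcept NC NR))) (I : Interpretation.{w} (Option NC) NR) :
    I.SatTBox (deltaTBox T E) ↔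
      I.reduct.SatTBox T ∧ ∀ x ∈ I.atom none, I.reduct.Typical E x := by
  simp only [Interpretation.SatTBox, deltaTBox, Finset.mem_union, Finset.mem_image, or_imp,
    forall_and, forall_exists_index, and_imp, forall_apply_eq_imp_iff₂, ELConcept.ext_lift,
    ELConcept.ext_withDelta]
  refine and_congr Iff.rfl ⟨fun h x hx a ha hl => h a ha ⟨hl, hx⟩, fun h a ha x hx => ?_⟩
  exact h x hx.2 a ha hx.1

theorem entails_withDelta_iff (T : Finset (GCI (ELConcept NC NR)))
    (E : Finset (DGCI (ELConcept NC NR))) (C D : ELConcept NC NR) :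
    Entails.{w} (deltaTBox T E) C.withDelta D.lift ↔
      ∀ I : Interpretation.{w} NC NR, I.SatTBox T →
        ∀ x, I.Typical E x → x ∈ C.ext I → x ∈ D.ext I := by
  constructor
  · intro h I hI x hx hC
    have hδ : ∀ y, y = x → I.Typical E y := fun y hy => hy ▸ hx
    -- With δ true at `x` only, the added inclusions constrain nothing but `x`.
    have h1 := h (I.expand {x}) ((satTBox_deltaTBox T E _).2 ⟨hI, hδ⟩)
    rw [ELConcept.ext_lift, ELConcept.ext_withDelta] at h1
    exact h1 ⟨hC, rfl⟩
  · intro h I hI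
    obtain ⟨hT, hE⟩ := (satTBox_deltaTBox T E I).1 hI
    rw [ELConcept.ext_lift, ELConcept.ext_withDelta]
    exact fun x hx => h I.reduct hT x (hE x hx.2) hx.1

theorem RankedInterpretation.isModel_toALC_iff (R : RankedInterpretation.{w} NC NR)
    (K : Ontology (ELConcept NC NR)) :
    R.IsModel K.toALC ↔ R.SatTBox K.tbox ∧
      ∀ a ∈ K.dbox, R.minimals (a.lhs.ext R.toInterpretation) ⊆ a.rhs.ext R.toInterpretation := by
  simp only [RankedInterpretation.IsModel, Ontology.toALC, Finset.mem_image, forall_exists_index,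
    and_imp, forall_apply_eq_imp_iff₂, RankedInterpretation.SatGCI, RankedInterpretation.SatDGCI,
    ELConcept.ext_toALC, Interpretation.SatTBox]

variable {test : SubsumptionTest.{u} NR}

theorem Ontology.toALC_filter (T : Finset (GCI (ELConcept NC NR)))
    (E : Finset (DGCI (ELConcept NC NR))) (p : DGCI (ALCConcept NC NR) → Prop) [DecidablePred p] :
    (⟨(Ontology.toALC ⟨T, E⟩).tbox, (Ontology.toALC ⟨T, E⟩).dbox.filter p⟩ :
      Ontology (ALCConcept NC NR)) =
      Ontology.toALC ⟨T, E.filter fun a => p ⟨a.lhs.toALC, a.rhs.toALC⟩⟩ :=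
  congrArg (Ontology.mk _) Finset.filter_image

theorem exceptional_subset (T : Finset (GCI (ELConcept NC NR)))
    (E : Finset (DGCI (ELConcept NC NR))) : exceptional test T E ⊆ E :=
  Finset.filter_subset _ _

theorem test_withDelta_bot_iff (htest : test.Correct.{w}) (T : Finset (GCI (ELConcept NC NR)))
    (E : Finset (DGCI (ELConcept NC NR))) (C : ELConcept NC NR) :
    test (Option NC) (deltaTBox T E) C.withDelta .bot = true ↔
      ∀ I : Interpretation.{w} NC NR, I.SatTBox T → ∀ x, I.Typical E x → x ∉ C.ext I :=
  (htest _ _ _ _).trans (entails_withDelta_iff T E C .bot)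

/-- If repeated application of `Exceptional` removes all defeasible inclusions, then ranked
exceptionality agrees with the materialisation test. -/
theorem isExceptional_toALC_iff (htest : test.Correct.{w}) {T : Finset (GCI (ELConcept NC NR))}
    {E : Finset (DGCI (ELConcept NC NR))} (hE : ∃ n, (exceptional test T)^[n] E = ∅)
    (X : ALCConcept NC NR) :
    IsExceptional.{w} (Ontology.toALC ⟨T, E⟩) X ↔
      ∀ I : Interpretation.{w} NC NR, I.SatTBox T → ∀ x, I.Typical E x → x ∉ X.ext I := by
  classical
  rw [isExceptional_iff]
  constructor
  · intro h I hI x hx hX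
    -- Each axiom has a last stage `j` containing it; the test fails there and supplies an instance
    -- of its left-hand side that is typical for stage `j`.
    have hstep : ∀ a ∈ E, ∃ j, a ∈ (exceptional test T)^[j] E ∧
        ∃ J : Interpretation.{w} NC NR, J.SatTBox T ∧
          ∃ y, J.Typical ((exceptional test T)^[j] E) y ∧ y ∈ a.lhs.ext J := by
      intro a ha
      have hex : ∃ j, a ∉ (exceptional test T)^[j] E :=
        hE.imp fun n hn => by rw [hn]; exact Finset.notMem_empty a
      obtain ⟨j, hj⟩ : ∃ j, Nat.find hex = j + 1 := Nat.exists_eq_succ_of_ne_zero fun h0 =>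
        (Nat.find_eq_zero hex).1 h0 ha
      have hmem : a ∈ (exceptional test T)^[j] E :=
        not_not.1 (Nat.find_min hex (by rw [hj]; exact j.lt_succ_self))
      refine ⟨j, hmem, ?_⟩
      have hnot := Nat.find_spec hex
      rw [hj, Function.iterate_succ_apply'] at hnot
      have ht : ¬ test (Option NC) (deltaTBox T ((exceptional test T)^[j] E))
          a.lhs.withDelta .bot = true := fun ht => hnot (Finset.mem_filter.2 ⟨hmem, ht⟩)
      rw [test_withDelta_bot_iff htest] at ht
      push Not at ht
      exact ht
    choose lvl hlvl J hJ y hy hyl using hstep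
    -- Indexing by `Fin E.card` rather than by `E` keeps the domain of the disjoint union in `Type
    -- w`.
    let e := E.equivFin
    let fam : Option (Fin E.card) → Interpretation.{w} NC NR := fun o =>
      o.elim I fun i => J (e.symm i) (e.symm i).2
    have hfam : ∀ o, (fam o).SatTBox T := by
      rintro (_ | i)
      · exact hI
      · exact hJ _ _
    -- The rank is defined everywhere because some stage is empty.
    have hrk : ∀ z : (Interpretation.sigma fam).Dom,
        ∃ j, (Interpretation.sigma fam).Typical ((exceptional test T)^[j] E) z := fun z =>
      hE.imp fun n hn => by rw [hn]; exact Interpretation.typical_empty _ z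
    refine h ((Interpretation.sigma fam).ranked fun z => Nat.find (hrk z)) ?_ ⟨none, x⟩ ?_
      ((ALCConcept.mem_ext_sigma fam X none x).2 hX)
    · refine (RankedInterpretation.isModel_toALC_iff _ _).2
        ⟨Interpretation.satTBox_sigma hfam, fun a ha z hz => ?_⟩
      obtain ⟨o, ho, hal⟩ : ∃ z : (Interpretation.sigma fam).Dom,
          (Interpretation.sigma fam).Typical ((exceptional test T)^[lvl a ha] E) z ∧
            z ∈ a.lhs.ext (Interpretation.sigma fam) := by
        obtain ⟨i, hi⟩ : ∃ i, e.symm i = ⟨a, ha⟩ := ⟨e ⟨a, ha⟩, e.symm_apply_apply _⟩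
        -- Generalising over `b` allows substitution despite the dependent types.
        have key : ∀ b : E, e.symm i = b → ∃ z : (fam (some i)).Dom,
            (fam (some i)).Typical ((exceptional test T)^[lvl b b.2] E) z ∧
              z ∈ b.1.lhs.ext (fam (some i)) := by
          rintro b rfl
          exact ⟨y _ _, hy _ _, hyl _ _⟩
        obtain ⟨z, hz1, hz2⟩ := key _ hi
        exact ⟨⟨some i, z⟩, (Interpretation.typical_sigma fam _ _ z).2 hz1,
          (ELConcept.mem_ext_sigma fam _ _ z).2 hz2⟩
      -- A minimal `a.lhs`-object ranks no higher than the witness for `a`; as stages decrease, `a`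
      -- still belongs to the stage at which `z` is typical.
      have hle : Nat.find (hrk z) ≤ lvl a ha := by
        by_contra hlt
        exact hz.2 ⟨o, hal, (Nat.find_min' (hrk o) ho).trans_lt (not_le.1 hlt)⟩
      have hanti : Antitone fun n => (exceptional test T)^[n] E :=
        antitone_nat_of_succ_le fun n => by
          rw [Function.iterate_succ_apply']
          exact exceptional_subset _ _
      exact Nat.find_spec (hrk z) a (hanti hle (hlvl a ha)) hz.1
    · intro z hz
      -- Stage `0` is `E` itself, so the counterexample `x` is globally minimal.
      have h0 : Nat.find (hrk ⟨none, x⟩) = 0 :=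
        (Nat.find_eq_zero _).2 ((Interpretation.typical_sigma fam _ none x).2 hx)
      have hz' : Nat.find (hrk z) < Nat.find (hrk ⟨none, x⟩) := hz
      omega
  -- A globally minimal object is minimal in every left-hand side containing it, hence typical for
  -- `E`.
  · intro h R hR x hx
    obtain ⟨hT, hD⟩ := (R.isModel_toALC_iff _).1 hR
    exact h R.toInterpretation hT x fun a ha hl => hD a ha ⟨hl, fun ⟨y, _, hy⟩ => hx y hy⟩

/-- The left-hand sides of a fixed point of `Exceptional` are empty in all ranked models. -/
theorem lhs_ext_eq_empty_of_exceptional_eq (htest : test.Correct.{w})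
    {T : Finset (GCI (ELConcept NC NR))} {E : Finset (DGCI (ELConcept NC NR))}
    (hE : exceptional test T E = E) {R : RankedInterpretation.{w} NC NR}
    (hR : R.IsModel (Ontology.toALC ⟨T, E⟩)) {a : DGCI (ELConcept NC NR)} (ha : a ∈ E) :
    a.lhs.ext R.toInterpretation = ∅ := by
  rw [Set.eq_empty_iff_forall_notMem]
  intro x hx
  obtain ⟨hT, hD⟩ := (R.isModel_toALC_iff _).1 hR
  obtain ⟨rk, hrk⟩ := R.modular
  -- An object of least rank in the union of all left-hand sides is typical for `E`, contradicting
  -- the exceptionality of `b`.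
  obtain ⟨y, ⟨b, hb, hy⟩, hmin⟩ := (measure rk).wf.has_min
    {y | ∃ b ∈ E, y ∈ b.lhs.ext R.toInterpretation} ⟨x, a, ha, hx⟩
  have hbt : test (Option NC) (deltaTBox T E) b.lhs.withDelta .bot = true := by
    rw [← hE] at hb
    exact (Finset.mem_filter.1 hb).2
  refine (test_withDelta_bot_iff htest T E b.lhs).1 hbt R.toInterpretation hT y ?_ hy
  exact fun c hc hyc => hD c hc ⟨hyc, fun ⟨z, hz, hzy⟩ => hmin z ⟨c, hc, hz⟩ ((hrk _ _).1 hzy)⟩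

theorem isModel_union_iff (htest : test.Correct.{w})
    {T : Finset (GCI (ELConcept NC NR))} {E : Finset (DGCI (ELConcept NC NR))}
    (hE : exceptional test T E = E) (Y : Finset (DGCI (ELConcept NC NR)))
    (R : RankedInterpretation.{w} NC NR) :
    R.IsModel (Ontology.toALC ⟨T, Y ∪ E⟩) ↔
      R.IsModel (Ontology.toALC ⟨T ∪ E.image fun a => ⟨a.lhs, .bot⟩, Y⟩) := by
  constructor
  · intro h
    obtain ⟨hT, hD⟩ := (R.isModel_toALC_iff _).1 h
    have hRE : R.IsModel (Ontology.toALC ⟨T, E⟩) := (R.isModel_toALC_iff _).2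
      ⟨hT, fun a ha => hD a (Finset.mem_union_right _ ha)⟩
    refine (R.isModel_toALC_iff _).2 ⟨fun a ha => ?_, fun a ha => hD a (Finset.mem_union_left _ ha)⟩
    rcases Finset.mem_union.1 ha with ha | ha
    · exact hT a ha
    · obtain ⟨b, hb, rfl⟩ := Finset.mem_image.1 ha
      exact (lhs_ext_eq_empty_of_exceptional_eq htest hE hRE hb).subset
  · intro h
    obtain ⟨hT, hD⟩ := (R.isModel_toALC_iff _).1 h
    refine (R.isModel_toALC_iff _).2
      ⟨fun a ha => hT a (Finset.mem_union_left _ ha), fun a ha => ?_⟩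
    rcases Finset.mem_union.1 ha with ha | ha
    · exact hD a ha
    · intro x hx
      exact (hT ⟨a.lhs, .bot⟩ (Finset.mem_union_right _ (Finset.mem_image_of_mem _ ha)) hx.1).elim

/-! ### Correctness of the loops. -/

theorem exceptional_exceptionalChain (T : Finset (GCI (ELConcept NC NR)))
    (E : Finset (DGCI (ELConcept NC NR))) :
    exceptional test T (exceptionalChain test T E).2 = (exceptionalChain test T E).2 := by
  induction E using exceptionalChain.induct test T with
  | case1 E h => rwa [exceptionalChain, if_pos h]
  | case2 E h ih => rwa [exceptionalChain, if_neg h]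

theorem exists_iterate_exceptional_eq (T : Finset (GCI (ELConcept NC NR)))
    (E : Finset (DGCI (ELConcept NC NR))) :
    ∃ n, (exceptional test T)^[n] E = (exceptionalChain test T E).2 := by
  induction E using exceptionalChain.induct test T with
  | case1 E h => exact ⟨0, by rw [exceptionalChain, if_pos h]; rfl⟩
  | case2 E h ih =>
    obtain ⟨n, hn⟩ := ih
    exact ⟨n + 1, by rw [exceptionalChain, if_neg h]; exact hn⟩

/-- The successive differences of the sequence computed by `exceptionalChain`. -/
def layers (test : SubsumptionTest.{u} NR) (T : Finset (GCI (ELConcept NC NR)))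
    (E : Finset (DGCI (ELConcept NC NR))) : List (Finset (DGCI (ELConcept NC NR))) :=
  List.zipWith (fun X Y => X \ Y) (exceptionalChain test T E).1
    ((exceptionalChain test T E).1.tail ++ [(exceptionalChain test T E).2])

/-- Exposes the head of the full sequence, which is the start set even when the list part is empty;
`layers_of_ne` needs this to unfold its `zipWith`. -/
theorem exceptionalChain_append (T : Finset (GCI (ELConcept NC NR)))
    (E : Finset (DGCI (ELConcept NC NR))) :
    (exceptionalChain test T E).1 ++ [(exceptionalChain test T E).2] =
      E :: ((exceptionalChain test T E).1 ++ [(exceptionalChain test T E).2]).tail := by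
  rw [exceptionalChain]
  split <;> rfl

theorem layers_of_eq {T : Finset (GCI (ELConcept NC NR))} {E : Finset (DGCI (ELConcept NC NR))}
    (h : exceptional test T E = E) : layers test T E = [] := by
  rw [layers, exceptionalChain, if_pos h]
  rfl

theorem layers_of_ne {T : Finset (GCI (ELConcept NC NR))} {E : Finset (DGCI (ELConcept NC NR))}
    (h : exceptional test T E ≠ E) :
    layers test T E = (E \ exceptional test T E) :: layers test T (exceptional test T E) := by
  have hc : exceptionalChain test T E = (E :: (exceptionalChain test T (exceptional test T E)).1,
      (exceptionalChain test T (exceptional test T E)).2) := by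
    rw [exceptionalChain, if_neg h]
  have ha := exceptionalChain_append (test := test) T (exceptional test T E)
  rw [layers, hc, List.tail_cons, ha, List.zipWith_cons_cons, layers]
  congr 1
  cases (exceptionalChain test T (exceptional test T E)).1 <;> rfl

/-- The search stops at the first `𝓔_j` for which the test fails, or with the empty set. -/
theorem searchRank_layers (T : Finset (GCI (ELConcept NC NR))) (C : ELConcept NC NR)
    (E : Finset (DGCI (ELConcept NC NR))) (hE : (exceptionalChain test T E).2 = ∅) :
    ∃ j, searchRank test T C E (layers test T E) = (exceptional test T)^[j] E ∧
      (∀ i < j, test (Option NC) (deltaTBox T ((exceptional test T)^[i] E))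
        C.withDelta .bot = true) ∧
      (test (Option NC) (deltaTBox T ((exceptional test T)^[j] E)) C.withDelta .bot = false ∨
        (exceptional test T)^[j] E = ∅) := by
  induction E using exceptionalChain.induct test T with
  | case1 E h =>
    rw [exceptionalChain, if_pos h] at hE
    exact ⟨0, by rw [layers_of_eq h]; rfl, fun i hi => absurd hi (Nat.not_lt_zero i), Or.inr hE⟩
  | case2 E h ih =>
    rw [exceptionalChain, if_neg h] at hE
    rw [layers_of_ne h, searchRank]
    split_ifs with ht
    · obtain ⟨j, hj, hlt, hend⟩ := ih hE
      refine ⟨j + 1, ?_, fun i hi => ?_, hend⟩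
      · rw [Finset.sdiff_sdiff_eq_self (exceptional_subset T E)]
        exact hj
      · cases i with
        | zero => exact ht.1
        | succ i => exact hlt i (Nat.lt_of_succ_lt_succ hi)
    · refine ⟨0, rfl, fun i hi => absurd hi (Nat.not_lt_zero i), Or.inl ?_⟩
      -- The loop cannot have stopped through emptiness here: `∅` is a fixed point of `exceptional`,
      -- excluded by `h`.
      refine Bool.eq_false_iff.2 fun htrue => ht ⟨htrue, ?_⟩
      rintro rfl
      exact h (Finset.subset_empty.1 (exceptional_subset T ∅))

theorem computeRanking_of_eq {T : Finset (GCI (ELConcept NC NR))}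
    {D : Finset (DGCI (ELConcept NC NR))} (h : (exceptionalChain test T D).2 = ∅) :
    computeRanking test T D = (⟨T, D⟩, layers test T D) := by
  rw [computeRanking, if_pos h, layers, h, Finset.image_empty, Finset.union_empty,
    Finset.sdiff_empty]

theorem computeRanking_of_ne {T : Finset (GCI (ELConcept NC NR))}
    {D : Finset (DGCI (ELConcept NC NR))} (h : (exceptionalChain test T D).2 ≠ ∅) :
    computeRanking test T D = computeRanking test
      (T ∪ (exceptionalChain test T D).2.image fun a => ⟨a.lhs, .bot⟩)
      (D \ (exceptionalChain test T D).2) := by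
  rw [computeRanking, if_neg h]

/-- Each further round shrinks the DBox. The set `Y` is arbitrary so that the equivalence of models
applies at every semantic level. -/
theorem computeRanking_spec (htest : test.Correct.{w}) (T : Finset (GCI (ELConcept NC NR)))
    (D : Finset (DGCI (ELConcept NC NR))) :
    ∃ (T' : Finset (GCI (ELConcept NC NR))) (D' : Finset (DGCI (ELConcept NC NR))),
      computeRanking test T D = (⟨T', D'⟩, layers test T' D') ∧
      (exceptionalChain test T' D').2 = ∅ ∧ T ⊆ T' ∧ D' ⊆ D ∧
      (∀ a ∈ D \ D', (⟨a.lhs, .bot⟩ : GCI (ELConcept NC NR)) ∈ T') ∧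
      ∀ (Y : Finset (DGCI (ELConcept NC NR))) (R : RankedInterpretation.{w} NC NR),
        R.IsModel (Ontology.toALC ⟨T, Y ∪ (D \ D')⟩) ↔ R.IsModel (Ontology.toALC ⟨T', Y⟩) := by
  induction hn : D.card using Nat.strong_induction_on generalizing T D with
  | _ n ih =>
    by_cases h : (exceptionalChain test T D).2 = ∅
    · refine ⟨T, D, computeRanking_of_eq h, h, subset_rfl, subset_rfl, ?_, ?_⟩
      · simp
      · simp
    · have hsub := exceptionalChain_snd_subset test T D
      have hfix := exceptional_exceptionalChain (test := test) T D
      rw [computeRanking_of_ne h]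
      generalize (exceptionalChain test T D).2 = F at h hsub hfix ⊢
      have hcard : (D \ F).card < n := by
        rw [← hn]
        exact Finset.card_lt_card (Finset.sdiff_ssubset hsub (Finset.nonempty_iff_ne_empty.2 h))
      obtain ⟨T', D', hr, hc, hT, hD, hbot, hmod⟩ :=
        ih _ hcard (T ∪ F.image fun a => ⟨a.lhs, .bot⟩) (D \ F) rfl
      have hsplit : D \ D' = ((D \ F) \ D') ∪ F := by
        ext a
        have h1 := @hsub a
        have h2 := @hD a
        simp only [Finset.mem_sdiff, Finset.mem_union] at h2 ⊢
        tauto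
      refine ⟨T', D', hr, hc, Finset.subset_union_left.trans hT, hD.trans Finset.sdiff_subset,
        ?_, fun Y R => ?_⟩
      · intro a ha
        rw [hsplit] at ha
        rcases Finset.mem_union.1 ha with ha | ha
        · exact hbot a ha
        · exact hT (Finset.mem_union_right _ (Finset.mem_image_of_mem _ ha))
      · rw [hsplit, ← Finset.union_assoc, isModel_union_iff htest hfix, hmod]

/-! ### Semantic levels versus syntactic stages. -/

/-- The semantic levels of `⟨T, D⟩` are computed by iterating `Exceptional` on an equivalent
ontology `⟨T', D'⟩` in which all defeasible inclusions have finite rank. -/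
theorem level_toALC_eq (htest : test.Correct.{w}) {T T' : Finset (GCI (ELConcept NC NR))}
    {D D' : Finset (DGCI (ELConcept NC NR))} (hc : ∃ n, (exceptional test T')^[n] D' = ∅)
    (hD : D' ⊆ D)
    (hbot : ∀ a ∈ D \ D', (⟨a.lhs, .bot⟩ : GCI (ELConcept NC NR)) ∈ T')
    (hmod : ∀ (Y : Finset (DGCI (ELConcept NC NR))) (R : RankedInterpretation.{w} NC NR),
      R.IsModel (Ontology.toALC ⟨T, Y ∪ (D \ D')⟩) ↔ R.IsModel (Ontology.toALC ⟨T', Y⟩))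
    (i : ℕ) :
    level.{w} (Ontology.toALC ⟨T, D⟩) i =
        Ontology.toALC ⟨T, (exceptional test T')^[i] D' ∪ (D \ D')⟩ ∧
      ∀ X, IsExceptional.{w} (level.{w} (Ontology.toALC ⟨T, D⟩) i) X ↔
        ∀ I : Interpretation.{w} NC NR, I.SatTBox T' →
          ∀ x, I.Typical ((exceptional test T')^[i] D') x → x ∉ X.ext I := by
  classical
  have hexc : ∀ (i : ℕ) (X : ALCConcept NC NR),
      IsExceptional.{w} (Ontology.toALC ⟨T, (exceptional test T')^[i] D' ∪ (D \ D')⟩) X ↔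
        ∀ I : Interpretation.{w} NC NR, I.SatTBox T' →
          ∀ x, I.Typical ((exceptional test T')^[i] D') x → x ∉ X.ext I := by
    intro i X
    have hc' : ∃ n, (exceptional test T')^[n] ((exceptional test T')^[i] D') = ∅ := by
      obtain ⟨n, hn⟩ := hc
      refine ⟨n, ?_⟩
      rw [← Function.iterate_add_apply, Nat.add_comm, Function.iterate_add_apply, hn]
      exact Function.iterate_fixed (Finset.subset_empty.1 (exceptional_subset T' ∅)) i
    rw [← isExceptional_toALC_iff htest hc']
    exact forall_congr' fun R => imp_congr_left (hmod _ R)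
  have hlevel : level.{w} (Ontology.toALC ⟨T, D⟩) i =
      Ontology.toALC ⟨T, (exceptional test T')^[i] D' ∪ (D \ D')⟩ := by
    induction i with
    | zero =>
      rw [level, Function.iterate_zero_apply, Finset.union_sdiff_of_subset hD]
    | succ i ih =>
      rw [level, ih]
      refine (Ontology.toALC_filter T ((exceptional test T')^[i] D' ∪ (D \ D')) fun a =>
        IsExceptional.{w} (Ontology.toALC ⟨T, (exceptional test T')^[i] D' ∪ (D \ D')⟩)
          a.lhs).trans ?_
      congr 2
      ext a
      have ha := hexc i a.lhs.toALC
      simp only [ELConcept.ext_toALC, ← test_withDelta_bot_iff htest] at ha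
      simp only [Finset.mem_filter, Finset.mem_union, Function.iterate_succ_apply', ha]
      rw [exceptional, Finset.mem_filter]
      -- Axioms of infinite rank survive every level, since `T'` makes their left-hand sides empty.
      have hb : a ∈ D \ D' → test (Option NC)
          (deltaTBox T' ((exceptional test T')^[i] D')) a.lhs.withDelta .bot = true :=
        fun hm => (test_withDelta_bot_iff htest _ _ _).2 fun I hI x _ hx => hI _ (hbot a hm) hx
      tauto
  exact ⟨hlevel, fun X => by rw [hlevel]; exact hexc i X⟩

end Procedure

end DefeasibleEL

/-! ### Soundness and completeness of the procedure. -/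

open DefeasibleEL in
theorem mainTheorem1 {NC : Type u} {NR : Type v} [DecidableEq NC] [DecidableEq NR]
    (test : DefeasibleEL.SubsumptionTest.{u} NR) (htest : test.Correct.{w})
    (K : DefeasibleEL.Ontology (DefeasibleEL.ELConcept NC NR))
    (C D : DefeasibleEL.ELConcept NC NR) :
    DefeasibleEL.InRationalClosure.{w} K.toALC C.toALC D.toALC ↔
      DefeasibleEL.rationalClosure test K C D = true := by
  obtain ⟨T, E⟩ := K
  obtain ⟨T', E', hr, hc, hT, hD, hbot, hmod⟩ := computeRanking_spec htest T E
  have hfin : ∃ n, (exceptional test T')^[n] E' = ∅ := by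
    rw [← hc]; exact exists_iterate_exceptional_eq T' E'
  have hexc := fun i => (level_toALC_eq htest hfin hD hbot hmod i).2
  have hcov : ∀ i, IsExceptional.{w} (level.{w} (Ontology.toALC ⟨T, E⟩) i)
      (.inf C.toALC D.toALC) → IsExceptional.{w} (level.{w} (Ontology.toALC ⟨T, E⟩) i)
      (.inf C.toALC (.neg D.toALC)) →
      IsExceptional.{w} (level.{w} (Ontology.toALC ⟨T, E⟩) i) C.toALC := by
    intro i h1 h2
    rw [hexc] at h1 h2 ⊢
    intro I hI x hx hC
    by_cases hxD : x ∈ D.toALC.ext I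
    · exact h1 I hI x hx ⟨hC, hxD⟩
    · exact h2 I hI x hx ⟨hC, hxD⟩
  have hinf : ∀ i X, IsExceptional.{w} (level.{w} (Ontology.toALC ⟨T, E⟩) i) C.toALC →
      IsExceptional.{w} (level.{w} (Ontology.toALC ⟨T, E⟩) i) (.inf C.toALC X) := by
    intro i X h
    rw [hexc] at h ⊢
    exact fun I hI x hx hX => h I hI x hx hX.1
  -- Here `C ⊓ ¬D` has rank `∞`, so either `C ⊓ D` has finite rank or `C` has rank `∞`. This settles
  -- both early exits.
  have hentails : Entails.{w} T' C D →
      InRationalClosure.{w} (Ontology.toALC ⟨T, E⟩) C.toALC D.toALC := by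
    intro h
    have hneg : ∀ i, IsExceptional.{w} (level.{w} (Ontology.toALC ⟨T, E⟩) i)
        (.inf C.toALC (.neg D.toALC)) := by
      intro i
      rw [hexc]
      rintro I hI x - ⟨hxC, hxD⟩
      rw [ELConcept.ext_toALC] at hxC
      refine hxD ?_
      rw [ELConcept.ext_toALC]
      exact h I hI hxC
    by_cases htop : conceptRank.{w} (Ontology.toALC ⟨T, E⟩) (.inf C.toALC D.toALC) = ⊤
    · exact Or.inr (conceptRank_eq_top_iff.2 fun i =>
        hcov i (conceptRank_eq_top_iff.1 htop i) (hneg i))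
    · left
      rw [conceptRank_eq_top_iff.2 hneg]
      exact lt_top_iff_ne_top.2 htop
  simp only [rationalClosure, hr]
  by_cases h1 : test NC T C D = true
  · rw [if_pos h1]
    refine iff_of_true (hentails fun I hI => ?_) rfl
    exact (htest _ _ _ _).1 h1 I fun a ha => hI a (hT ha)
  rw [if_neg h1]
  by_cases h2 : test NC T' C D = true
  · rw [if_pos h2]
    exact iff_of_true (hentails ((htest _ _ _ _).1 h2)) h2
  rw [if_neg h2]
  obtain ⟨j, hj, hlt, hend⟩ := searchRank_layers T' C E' hc
  rw [hj]
  -- If the test still succeeded with no defeasible axioms left, `T'` would entail `C ⊑ ⊥`, and the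
  -- second exit would have been taken.
  have hjf : test (Option NC) (deltaTBox T' ((exceptional test T')^[j] E'))
      C.withDelta .bot = false := by
    rcases hend with h | h
    · exact h
    · refine Bool.eq_false_iff.2 fun ht => h2 ((htest _ _ _ _).2 fun I hI x hx => ?_)
      rw [h, test_withDelta_bot_iff htest] at ht
      exact (ht I hI x (I.typical_empty x) hx).elim
  rw [if_pos hjf, htest _ _ _ _, entails_withDelta_iff]
  have hCexc : ∀ i, IsExceptional.{w} (level.{w} (Ontology.toALC ⟨T, E⟩) i) C.toALC ↔
      test (Option NC) (deltaTBox T' ((exceptional test T')^[i] E')) C.withDelta .bot = true := by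
    intro i
    simp only [hexc, test_withDelta_bot_iff htest, ELConcept.ext_toALC]
  have hCj : ¬ IsExceptional.{w} (level.{w} (Ontology.toALC ⟨T, E⟩) j) C.toALC := by
    rw [hCexc, hjf]
    exact Bool.false_ne_true
  have hneg : IsExceptional.{w} (level.{w} (Ontology.toALC ⟨T, E⟩) j)
      (.inf C.toALC (.neg D.toALC)) ↔ ∀ I : Interpretation.{w} NC NR, I.SatTBox T' →
        ∀ x, I.Typical ((exceptional test T')^[j] E') x → x ∈ C.ext I → x ∈ D.ext I := by
    rw [hexc]
    refine forall₄_congr fun I _ x _ => ?_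
    simp only [ALCConcept.ext, ELConcept.ext_toALC, Set.mem_inter_iff, Set.mem_compl_iff, not_and,
      not_not]
  rw [← hneg]
  constructor
  · rintro (h | h)
    · obtain ⟨i, hi, hni⟩ := exists_conceptRank_eq h.ne_top
      rw [hi] at h
      -- The rank `i` of `C ⊓ D` is at least `j`, because `C` is exceptional at all levels below
      -- `j`.
      refine isExceptional_of_lt_conceptRank (lt_of_le_of_lt (Nat.cast_le.2 ?_) h)
      by_contra hij
      exact hni (hinf i _ ((hCexc i).2 (hlt i (not_le.1 hij))))
    · exact absurd (conceptRank_eq_top_iff.1 h j) hCj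
  · intro h
    -- At level `j` one of `C ⊓ D`, `C ⊓ ¬D` is not exceptional; by `h` it is the former, so its
    -- rank is at most `j`.
    refine Or.inl (lt_of_le_of_lt (conceptRank_le fun hCD => hCj (hcov j hCD h)) ?_)
    refine lt_conceptRank fun i hi => ?_
    rcases hi.lt_or_eq with hi | rfl
    · exact hinf i _ ((hCexc i).2 (hlt i hi))
    · exact h
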